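/- Let $a>b>0$, let $\mathcal{E}$ be the ellipse $x^2/a^2+y^2/b^2=1$, and put $c^2=a^2-b^2$. Let $\mathcal{K}$ be a circle with centre $C=[x_c,y_c]$ such that there is at least one triangle inscribed in $\mathcal{E}$ with incircle $\mathcal{K}$, and let $\mathcal{T}_\circ$ be the (Poncelet) family of all triangles inscribed in $\mathcal{E}$ with incircle $\mathcal{K}$. For a triangle with distinct incenter $X_1$ and circumcenter, let $X_{36}$ be the inverse of $X_1$ with respect to the circumcircle. Put \begin{align*} \delta&=\sqrt{(b^4+c^2y_c^2)(a^4-c^2x_c^2)},\qquad \delta_4=\sqrt{a^4-c^2x_c^2},\qquad \delta_4'=\sqrt{b^4+c^2y_c^2},\\ z_2&=a^6b^2-9a^6y_c^2-a^4b^2x_c^2,\\ z_1&=z_2-2a^4b^4-6a^4b^2y_c^2+a^2b^6-6a^2b^4x_c^2-a^2b^4y_c^2-9b^6x_c^2,\\ x_{36}&=x_c\left(z_2-6a^4b^4+6a^4b^2y_c^2-3a^2b^6-2a^2b^4x_c^2+3a^2b^4y_c^2-8ab^3\delta+3b^6x_c^2\right),\\ y_{36}&=y_c\left(3a^6(y_c^2-b^2)-a^4\left(6b^4+b^2(2y_c^2-3x_c^2)\right)-8a^3b\,\delta+a^2b^4(b^2+6x_c^2-y_c^2)-9b^6x_c^2\right),\\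 z_{36}&=5ba^4y_c^2-b^3a^2(a^2+y_c^2-x_c^2)+b^5(a^2+3x_c^2),\\ z_{36}'&=5ab^4x_c^2-a^3b^2(b^2+x_c^2-y_c^2)+a^5(b^2+3y_c^2), \end{align*} and suppose that $z_1\neq 0$. Then no triangle of $\mathcal{T}_\circ$ has its incenter at its circumcenter, and the locus of $X_{36}$ over $\mathcal{T}_\circ$ is exactly the circle with centre \[ C_{36}=\left[\frac{x_{36}}{z_1},\frac{y_{36}}{z_1}\right] \] and radius \[ r_{36}=\left|\frac{2(\delta_4z_{36}-\delta_4'z_{36}')}{a^2b^2c^4-b^2(a^2+3b^2)^2x_c^2-a^2(3a^2+b^2)^2y_c^2}\right|>0. \] -/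

import Mathlib

noncomputable section

namespace Poncelet

/-- The Euclidean plane. -/
abbrev Plane : Type := EuclideanSpace ℝ (Fin 2)

/-- The ellipse `x² / a² + y² / b² = 1` with centre the origin and semi-axes `a`, `b`. -/
def ellipse (a b : ℝ) : Set Plane :=
  {P | P 0 ^ 2 / a ^ 2 + P 1 ^ 2 / b ^ 2 = 1}

/-- The family of all (nondegenerate) triangles inscribed in the ellipse with semi-axes `a`, `b`
and circumscribing the circle with centre `C` and radius `r`, i.e. having it as incircle. -/
def family (a b : ℝ) (C : Plane) (r : ℝ) : Set (Affine.Triangle ℝ Plane) :=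
  {T | (∀ i, T.points i ∈ ellipse a b) ∧ T.insphere = ⟨C, r⟩}

/-- The triangle centre `X₃₆`: the inverse of the incenter in the circumcircle
(meaningful when the incenter and the circumcenter are distinct). -/
def X36 (T : Affine.Triangle ℝ Plane) : Plane :=
  EuclideanGeometry.inversion T.circumcenter T.circumradius T.incenter

/-- The locus of `X₃₆` over the family. -/
def locus36 (a b : ℝ) (C : Plane) (r : ℝ) : Set Plane :=
  X36 '' family a b C r

/-- `c² = a² - b²`. -/
def csq (a b : ℝ) : ℝ := a ^ 2 - b ^ 2

def δ (a b x y : ℝ) : ℝ :=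
  Real.sqrt ((b ^ 4 + csq a b * y ^ 2) * (a ^ 4 - csq a b * x ^ 2))

def z₂ (a b x y : ℝ) : ℝ :=
  a ^ 6 * b ^ 2 - 9 * a ^ 6 * y ^ 2 - a ^ 4 * b ^ 2 * x ^ 2

def z₁ (a b x y : ℝ) : ℝ :=
  z₂ a b x y - 2 * a ^ 4 * b ^ 4 - 6 * a ^ 4 * b ^ 2 * y ^ 2 + a ^ 2 * b ^ 6
    - 6 * a ^ 2 * b ^ 4 * x ^ 2 - a ^ 2 * b ^ 4 * y ^ 2 - 9 * b ^ 6 * x ^ 2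

def x₃₆ (a b x y : ℝ) : ℝ :=
  x * (z₂ a b x y - 6 * a ^ 4 * b ^ 4 + 6 * a ^ 4 * b ^ 2 * y ^ 2 - 3 * a ^ 2 * b ^ 6
    - 2 * a ^ 2 * b ^ 4 * x ^ 2 + 3 * a ^ 2 * b ^ 4 * y ^ 2 - 8 * a * b ^ 3 * δ a b x y
    + 3 * b ^ 6 * x ^ 2)

def y₃₆ (a b x y : ℝ) : ℝ :=
  y * (3 * a ^ 6 * (y ^ 2 - b ^ 2) - a ^ 4 * (6 * b ^ 4 + b ^ 2 * (2 * y ^ 2 - 3 * x ^ 2))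
    - 8 * a ^ 3 * b * δ a b x y + a ^ 2 * b ^ 4 * (b ^ 2 + 6 * x ^ 2 - y ^ 2)
    - 9 * b ^ 6 * x ^ 2)

/-- The centre of the locus of `X₃₆`, for the caustic centre `[x, y]`. -/
def C36 (a b x y : ℝ) : Plane :=
  !₂[x₃₆ a b x y / z₁ a b x y, y₃₆ a b x y / z₁ a b x y]

def δ₄ (a b x : ℝ) : ℝ := Real.sqrt (a ^ 4 - csq a b * x ^ 2)

def δ₄' (a b y : ℝ) : ℝ := Real.sqrt (b ^ 4 + csq a b * y ^ 2)

def z₃₆ (a b x y : ℝ) : ℝ :=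
  5 * b * a ^ 4 * y ^ 2 - b ^ 3 * a ^ 2 * (a ^ 2 + y ^ 2 - x ^ 2) + b ^ 5 * (a ^ 2 + 3 * x ^ 2)

def z₃₆' (a b x y : ℝ) : ℝ :=
  5 * a * b ^ 4 * x ^ 2 - a ^ 3 * b ^ 2 * (b ^ 2 + x ^ 2 - y ^ 2) + a ^ 5 * (b ^ 2 + 3 * y ^ 2)

/-- The radius of the locus of `X₃₆`. The absolute value is needed: the quotient is negative when
its denominator is positive, e.g. it equals `-2ab/(a-b)` for `x = y = 0`. -/
def r36 (a b x y : ℝ) : ℝ :=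
  |2 * (δ₄ a b x * z₃₆ a b x y - δ₄' a b y * z₃₆' a b x y) /
    (a ^ 2 * b ^ 2 * csq a b ^ 2 - b ^ 2 * (a ^ 2 + 3 * b ^ 2) ^ 2 * x ^ 2
      - a ^ 2 * (3 * a ^ 2 + b ^ 2) ^ 2 * y ^ 2)|

end Poncelet

end

namespace Poncelet

open scoped ComplexConjugate RealInnerProductSpace

/-! Take the incircle as the unit circle of `ℂ`. A triangle is then given by its contact points `u`,
`v`, `w`, and its vertices are the poles `2uv/(u+v)` of the chords. A pole lies on the ellipse iff a
symmetric polynomial, quadratic in each of `u` and `v`, vanishes (`conicForm`). For three chords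
this amounts to `u+v+w = s + p*uvw`, together with one relation between `s`, `p` and the conic that
involves no triangle (`closure_of_conicForm`, `conicForm_eq_zero_of_closure`). So the orthocentre `h
= u+v+w` of the contact triangle lies on the circle `‖h - s‖ = p`.

Since `X36` is `2h/‖h‖²` (`X36_eq`), its locus is the image of that circle under an inversion
(`norm_inverse_sub`). All of the circle is attained: `‖s‖ + p < 1`, so `‖h‖ < 1`, and the cubic with
orthocentre `h` and product `(h-s)/p` has its three roots on the unit circle (`exists_unit_triple`).

The closed formulas follow because the relation fixes the inradius, `c²r = bδ₄ - aδ₄'`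
(`csq_mul_radius`), after which every constant factors over `δ₄`, `δ₄'`. The hypothesis `z₁ ≠ 0`
keeps the circle of orthocentres away from `0`. -/

/-! ### Incircles described by unit normals to the sides. -/

lemma inner_plane (p q : Plane) : ⟪p, q⟫ = p 0 * q 0 + p 1 * q 1 := by
  simp [PiLp.inner_apply, Fin.sum_univ_two, mul_comm]

lemma norm_sq_plane (p : Plane) : ‖p‖ ^ 2 = p 0 ^ 2 + p 1 ^ 2 := by
  simp [EuclideanSpace.norm_sq_eq, Fin.sum_univ_two]

/-- Two vectors of the plane orthogonal to a common nonzero vector are parallel. -/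
lemma norm_eq_abs_inner_of_orthogonal {n x d : Plane} (hn : ‖n‖ = 1) (hd : d ≠ 0)
    (hnd : ⟪n, d⟫ = 0) (hxd : ⟪x, d⟫ = 0) : ‖x‖ = |⟪n, x⟫| := by
  have hn2 := norm_sq_plane n
  have hx2 := norm_sq_plane x
  have hd2 : d 0 ^ 2 + d 1 ^ 2 ≠ 0 := by
    rw [← norm_sq_plane]
    exact pow_ne_zero 2 (norm_ne_zero_iff.2 hd)
  rw [inner_plane] at hnd hxd
  have hpar : n 0 * x 1 - n 1 * x 0 = 0 := by
    refine (mul_eq_zero.1 ?_).resolve_left hd2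
    linear_combination (d 0 * x 1 - d 1 * x 0) * hnd + (d 1 * n 0 - d 0 * n 1) * hxd
  rw [← abs_norm x, ← sq_eq_sq_iff_abs_eq_abs, inner_plane, hx2]
  rw [hn, one_pow] at hn2
  linear_combination (x 0 ^ 2 + x 1 ^ 2) * hn2 + (n 0 * x 1 - n 1 * x 0) * hpar

/-- A functional that is constant on the opposite side of a triangle computes the height. -/
lemma height_eq_abs (T : Affine.Triangle ℝ Plane) (i : Fin 3) {n C : Plane} {r : ℝ}
    (hn : ‖n‖ = 1) (h : ∀ j, j ≠ i → ⟪n, T.points j - C⟫ = r) :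
    T.height i = |⟪n, T.points i - C⟫ - r| := by
  have hfoot : ⟪n, T.altitudeFoot i - C⟫ = r := by
    have hm := T.altitudeFoot_mem_affineSpan_image_compl i
    refine affineSpan_induction (p := fun x ↦ ⟪n, x - C⟫ = r) hm ?_ ?_
    · rintro _ ⟨j, hj, rfl⟩
      exact h j hj
    · intro c u v w hu hv hw
      simp only [inner_sub_right] at hu hv hw
      simp only [vsub_eq_sub, vadd_eq_add, inner_sub_right, inner_add_right, inner_smul_right]
      linear_combination c * hu - c * hv + hw
  obtain ⟨j, k, hji, hki, hjk⟩ : ∃ j k : Fin 3, j ≠ i ∧ k ≠ i ∧ j ≠ k := by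
    clear hfoot h
    decide +revert
  have hd : T.points j - T.points k ≠ 0 := sub_ne_zero.2 (T.independent.injective.ne hjk)
  have hnd : ⟪n, T.points j - T.points k⟫ = 0 := by
    have h1 := h j hji
    have h2 := h k hki
    rw [inner_sub_right] at h1 h2 ⊢
    linear_combination h1 - h2
  have hxd : ⟪T.points i - T.altitudeFoot i, T.points j - T.points k⟫ = 0 := by
    have h1 := T.inner_vsub_vsub_altitudeFoot_eq_height_sq hji.symm
    have h2 := T.inner_vsub_vsub_altitudeFoot_eq_height_sq hki.symm
    simp only [vsub_eq_sub] at h1 h2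
    rw [real_inner_comm, inner_sub_left]
    rw [inner_sub_left] at h1 h2
    linear_combination h2 - h1
  rw [Affine.Simplex.height, dist_eq_norm, norm_eq_abs_inner_of_orthogonal hn hd hnd hxd]
  congr 1
  rw [inner_sub_right] at hfoot ⊢
  rw [inner_sub_right]
  linear_combination -hfoot

/-- The affine function `X ↦ ⟪n, X - C⟫ - r` equals `-r` at `C` and vanishes at the vertices other
than `i`, so expanding it in barycentric coordinates leaves one term. -/
lemma weight_mul_inner_sub {P : Fin 3 → Plane} {w : Fin 3 → ℝ} {n C : Plane} {r : ℝ} {i : Fin 3}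
    (h : ∀ j, j ≠ i → ⟪n, P j - C⟫ = r) (hw1 : ∑ i, w i = 1) (hwC : ∑ i, w i • P i = C) :
    w i * (⟪n, P i - C⟫ - r) = -r := by
  have hsum : ∑ j, w j * ⟪n, P j - C⟫ = 0 := by
    simp_rw [inner_sub_right, mul_sub, Finset.sum_sub_distrib, ← Finset.sum_mul, hw1,
      ← inner_smul_right, ← inner_sum, hwC]
    simp
  have hsingle : ∑ j, w j * (⟪n, P j - C⟫ - r) = w i * (⟪n, P i - C⟫ - r) :=
    Finset.sum_eq_single_of_mem i (Finset.mem_univ i) fun j _ hj ↦ by rw [h j hj]; ring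
  rw [← hsingle]
  simp_rw [mul_sub, Finset.sum_sub_distrib, ← Finset.sum_mul, hw1, hsum]
  ring

/-- Tangent-side description of the incircle of a triangle. -/
lemma exists_normals_of_insphere {T : Affine.Triangle ℝ Plane} {C : Plane} {r : ℝ}
    (h : T.insphere = ⟨C, r⟩) :
    0 < r ∧ ∃ (n : Fin 3 → Plane) (w : Fin 3 → ℝ), (∀ i, ‖n i‖ = 1) ∧
      (∀ i j, j ≠ i → ⟪n i, T.points j - C⟫ = r) ∧
      (∀ i, ⟪n i, T.points i - C⟫ < -r) ∧
      (∀ i, 0 < w i) ∧ ∑ i, w i = 1 ∧ ∑ i, w i • T.points i = C := by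
  have hr : T.inradius = r := by
    have := congrArg EuclideanGeometry.Sphere.radius h
    simpa using this
  have hC : T.incenter = C := by
    have := congrArg EuclideanGeometry.Sphere.center h
    simpa using this
  have hr0 : 0 < r := hr ▸ T.inradius_pos
  have hw1 : ∑ i, T.excenterWeights ∅ i = 1 :=
    T.excenterExists_empty.sum_excenterWeights_eq_one
  have hwC : ∑ i, T.excenterWeights ∅ i • T.points i = C := by
    rw [← hC, T.incenter_eq_affineCombination,
      Finset.affineCombination_eq_linear_combination _ _ _ hw1]
  have hnorm (i) : ‖T.touchpoint ∅ i - C‖ = r := by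
    rw [← hC, ← hr, ← T.dist_incenter i, dist_comm, dist_eq_norm]
  have hn (i j) (hij : j ≠ i) : ⟪r⁻¹ • (T.touchpoint ∅ i - C), T.points j - C⟫ = r := by
    have h1 := (T.isTangentAt_insphere_touchpoint i).inner_right_eq_zero_of_mem
      (x := T.points j) (by
        rw [Affine.Simplex.range_faceOpposite_points]
        exact subset_affineSpan _ _ ⟨j, hij, rfl⟩)
    rw [h] at h1
    simp only [vsub_eq_sub] at h1
    have h2 : T.points j - C = (T.points j - T.touchpoint ∅ i) + (T.touchpoint ∅ i - C) := by abel
    rw [h2, inner_add_right, real_inner_smul_left, real_inner_smul_left, h1,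
      real_inner_self_eq_norm_sq, hnorm]
    field_simp
    ring
  refine ⟨hr0, fun i ↦ r⁻¹ • (T.touchpoint ∅ i - C), T.excenterWeights ∅, fun i ↦ ?_, hn,
    fun i ↦ ?_, T.excenterWeights_empty_pos, hw1, hwC⟩
  · rw [norm_smul, hnorm, norm_inv, Real.norm_of_nonneg hr0.le, inv_mul_cancel₀ hr0.ne']
  · set n := r⁻¹ • (T.touchpoint ∅ i - C)
    have hsum := weight_mul_inner_sub (hn i) hw1 hwC
    have h0 := T.excenterWeights_empty_pos i
    -- A weight below `1/2` in `hsum` forces `⟪n, T.points i - C⟫ - r < -2r`. This strict bound is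
    -- what later makes the contact triangle acute.
    have h2 := T.excenterWeights_empty_lt_inv_two i
    set w := T.excenterWeights ∅ i
    by_contra! hcon
    have h3 : w * -r ≤ w * ⟪n, T.points i - C⟫ := mul_le_mul_of_nonneg_left hcon h0.le
    have h4 : 0 < (2⁻¹ - w) * r := mul_pos (sub_pos.2 h2) hr0
    linarith

/-- A triangle whose sides are tangent to a circle centred at an interior point has that circle as
its incircle. -/
lemma insphere_eq_of_normals {T : Affine.Triangle ℝ Plane} {C : Plane} {r : ℝ} (hr : 0 < r)
    (n : Fin 3 → Plane) (w : Fin 3 → ℝ) (hn : ∀ i, ‖n i‖ = 1)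
    (h : ∀ i j, j ≠ i → ⟪n i, T.points j - C⟫ = r) (hw : ∀ i, 0 < w i) (hw1 : ∑ i, w i = 1)
    (hwC : ∑ i, w i • T.points i = C) : T.insphere = ⟨C, r⟩ := by
  -- The incenter weights are the normalised inverse heights, so it is enough that each height is `r
  -- / w i`.
  have hheight (i) : (T.height i)⁻¹ = w i / r := by
    have hsum := weight_mul_inner_sub (h i) hw1 hwC
    have h1 : ⟪n i, T.points i - C⟫ - r = -(r / w i) := by
      have := (hw i).ne'
      field_simp
      linear_combination hsum
    rw [height_eq_abs T i (hn i) (h i), h1, abs_neg, abs_of_pos (div_pos hr (hw i)), inv_div]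
  have hunn (i) : T.excenterWeightsUnnorm ∅ i = w i / r := by
    rw [T.excenterWeightsUnnorm_empty_apply, hheight]
  have hsumU : ∑ i, T.excenterWeightsUnnorm ∅ i = r⁻¹ := by
    simp_rw [hunn, ← Finset.sum_div, hw1, one_div]
  have hweights : T.excenterWeights ∅ = w := by
    ext i
    rw [Affine.Simplex.excenterWeights, hsumU, Pi.smul_apply, hunn, smul_eq_mul]
    field_simp
  rw [Affine.Simplex.insphere, Affine.Simplex.exsphere, hsumU, hweights, inv_inv, abs_of_pos hr,
    Finset.affineCombination_eq_linear_combination _ _ _ hw1, hwC]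

/-- The `i`-th functional, shifted by `r`, vanishes at every vertex except the `i`-th, hence
isolates the `i`-th coefficient of any affine relation. -/
lemma affineIndependent_of_normals {P n : Fin 3 → Plane} {C : Plane} {r : ℝ}
    (h : ∀ i j, j ≠ i → ⟪n i, P j - C⟫ = r) (h' : ∀ i, ⟪n i, P i - C⟫ ≠ r) :
    AffineIndependent ℝ P := by
  rw [affineIndependent_iff]
  intro s w hw0 hwP i hi
  have hsum : ∑ j ∈ s, w j * (⟪n i, P j - C⟫ - r) = 0 := by
    simp_rw [inner_sub_right, mul_sub, Finset.sum_sub_distrib, ← Finset.sum_mul, hw0,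
      ← inner_smul_right, ← inner_sum, hwP]
    simp
  rw [Finset.sum_eq_single_of_mem i hi (fun j _ hj ↦ by rw [h i j hj]; ring)] at hsum
  exact (mul_eq_zero.1 hsum).resolve_right (sub_ne_zero.2 (h' i))

/-! ### Triples of points of the unit circle. -/

lemma mul_conj_of_norm_one {u : ℂ} (hu : ‖u‖ = 1) : u * conj u = 1 := by
  rw [Complex.mul_conj, Complex.normSq_eq_norm_sq, hu]
  simp

lemma ne_zero_of_norm_one {u : ℂ} (hu : ‖u‖ = 1) : u ≠ 0 := by
  rintro rfl
  simp at hu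

/-- A Blaschke-factor argument: the equation says `t²(t-h) = ε(1 - conj h * t)`, and `|1 - conj h *
t|² - |t-h|² = (1-|h|²)(1-|t|²)`. Comparing squared moduli gives `|t|² - 1` times a positive
quantity equal to zero. -/
lemma norm_eq_one_of_cubic {h ε t : ℂ} (hh : ‖h‖ < 1) (hε : ‖ε‖ = 1)
    (ht : t ^ 3 - h * t ^ 2 + ε * conj h * t - ε = 0) : ‖t‖ = 1 := by
  have h1 : t ^ 2 * (t - h) = ε * (1 - conj h * t) := by linear_combination ht
  have h2 := congrArg Complex.normSq h1
  have hε' : Complex.normSq ε = 1 := by rw [Complex.normSq_eq_norm_sq, hε, one_pow]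
  rw [map_mul, map_mul, map_pow, hε', one_mul] at h2
  have h3 : Complex.normSq (1 - conj h * t) =
      Complex.normSq (t - h) + (1 - Complex.normSq h) * (1 - Complex.normSq t) := by
    simp [Complex.normSq_apply]
    ring
  have hh' : Complex.normSq h < 1 := by
    rw [Complex.normSq_eq_norm_sq]
    nlinarith [norm_nonneg h]
  have h4 : 0 < (Complex.normSq t + 1) * Complex.normSq (t - h) + (1 - Complex.normSq h) := by
    have := Complex.normSq_nonneg t
    have := Complex.normSq_nonneg (t - h)
    have : 0 < 1 - Complex.normSq h := by linarith
    positivity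
  have h5 : Complex.normSq t - 1 = 0 := by
    refine (mul_eq_zero.1 ?_).resolve_right h4.ne'
    linear_combination h2 + h3
  rw [Complex.normSq_eq_norm_sq] at h5
  nlinarith [norm_nonneg t]

/-- Every orthocentre `h` in the open unit disc and product `ε` on the unit circle come from a
triple of points of the unit circle. -/
lemma exists_unit_triple {h ε : ℂ} (hh : ‖h‖ < 1) (hε : ‖ε‖ = 1) :
    ∃ u v w : ℂ, ‖u‖ = 1 ∧ ‖v‖ = 1 ∧ ‖w‖ = 1 ∧ u + v + w = h ∧ u * v * w = ε := by
  -- On the unit circle conjugation is inversion, so the second symmetric function must be the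
  -- product times the conjugate of the sum; this dictates the coefficient `ε * conj h`.
  let P : Cubic ℂ := ⟨1, -h, ε * conj h, -ε⟩
  have ha : P.a ≠ 0 := one_ne_zero
  obtain ⟨u, v, w, huvw⟩ := (Cubic.splits_iff_roots_eq_three (φ := RingHom.id ℂ) ha).1
    (IsAlgClosed.splits _)
  have hb := Cubic.b_eq_three_roots ha huvw
  have hc := Cubic.c_eq_three_roots ha huvw
  have hd := Cubic.d_eq_three_roots ha huvw
  simp only [P, RingHom.id_apply] at hb hc hd
  have key (t : ℂ) (ht : (t - u) * (t - v) * (t - w) = 0) : ‖t‖ = 1 :=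
    norm_eq_one_of_cubic hh hε (by linear_combination ht + t ^ 2 * hb + t * hc + hd)
  exact ⟨u, v, w, key u (by simp), key v (by simp), key w (by simp),
    by linear_combination hb, by linear_combination hd⟩

lemma pairwise_mul_eq {u v w : ℂ} (hu : ‖u‖ = 1) (hv : ‖v‖ = 1) (hw : ‖w‖ = 1) :
    u * v + v * w + w * u = u * v * w * conj (u + v + w) := by
  rw [map_add, map_add]
  linear_combination -(v * w) * mul_conj_of_norm_one hu - (w * u) * mul_conj_of_norm_one hv
    - (u * v) * mul_conj_of_norm_one hw

lemma add_ne_zero_of_norm_lt {u v w : ℂ} (hw : ‖w‖ = 1) (h : ‖u + v + w‖ < 1) : u + v ≠ 0 := by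
  intro h0
  rw [h0, zero_add, hw] at h
  exact lt_irrefl _ h

lemma ne_of_norm_lt {u v w : ℂ} (hu : ‖u‖ = 1) (hw : ‖w‖ = 1) (h : ‖u + v + w‖ < 1) :
    u ≠ v := by
  rintro rfl
  have h1 : ‖(u + u)‖ ≤ ‖u + u + w‖ + ‖w‖ := by
    simpa using norm_sub_le (u + u + w) w
  rw [← two_mul, norm_mul, hu, hw] at h1
  norm_num at h1
  rw [two_mul] at h1
  linarith

/-! ### Poles of chords of the unit circle. -/

/-- The intersection of the tangents to the unit circle at `u` and `v`. -/
noncomputable def pole (u v : ℂ) : ℂ := 2 * u * v / (u + v)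

lemma pole_comm (u v : ℂ) : pole u v = pole v u := by
  unfold pole
  rw [add_comm v u]
  ring

lemma conj_pole {u v : ℂ} (hu : ‖u‖ = 1) (hv : ‖v‖ = 1) (huv : u + v ≠ 0) :
    conj (pole u v) = 2 / (u + v) := by
  have hc : conj u + conj v ≠ 0 := by
    rw [← map_add]
    exact (map_ne_zero _).2 huv
  rw [pole, map_div₀, map_mul, map_mul, map_add, Complex.conj_ofNat, div_eq_div_iff hc huv]
  linear_combination 2 * conj v * mul_conj_of_norm_one hu
    + 2 * conj u * mul_conj_of_norm_one hv

/-- The real inner product of two complex numbers. -/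
lemma re_mul_re_add_im_mul_im (z u : ℂ) :
    ((u.re * z.re + u.im * z.im : ℝ) : ℂ) = (u * conj z + conj u * z) / 2 := by
  apply Complex.ext
  · simp
  · simp
    ring

lemma inner_pole {u v : ℂ} (hu : ‖u‖ = 1) (hv : ‖v‖ = 1) (huv : u + v ≠ 0) :
    u.re * (pole u v).re + u.im * (pole u v).im = 1 := by
  apply Complex.ofReal_injective
  rw [re_mul_re_add_im_mul_im, conj_pole hu hv huv, pole, Complex.ofReal_one]
  field_simp
  linear_combination v * mul_conj_of_norm_one hu

lemma eq_pole {u v z : ℂ} (hu : ‖u‖ = 1) (hv : ‖v‖ = 1) (huv : u ≠ v)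
    (h1 : u.re * z.re + u.im * z.im = 1) (h2 : v.re * z.re + v.im * z.im = 1) :
    u + v ≠ 0 ∧ z = pole u v := by
  have h1' := re_mul_re_add_im_mul_im z u
  have h2' := re_mul_re_add_im_mul_im z v
  rw [h1, Complex.ofReal_one] at h1'
  rw [h2, Complex.ofReal_one] at h2'
  have hu' := mul_conj_of_norm_one hu
  have hv' := mul_conj_of_norm_one hv
  have h3 : (u + v) * conj z = 2 := by
    apply mul_left_cancel₀ (sub_ne_zero.2 huv)
    linear_combination z * (hv' - hu') - 2 * u * h1' + 2 * v * h2'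
  have hne : u + v ≠ 0 := by
    intro h0
    simp [h0] at h3
  refine ⟨hne, ?_⟩
  rw [pole, eq_div_iff hne]
  have h4 : z = 2 * u - u ^ 2 * conj z := by
    linear_combination -z * hu' - 2 * u * h1'
  linear_combination (u + v) * h4 - u ^ 2 * h3

/-- The value at the third pole of the functional given by a point of tangency. -/
lemma inner_pole_opposite {u v w : ℂ} (hu : ‖u‖ = 1) (hv : ‖v‖ = 1) (hw : ‖w‖ = 1)
    (hvw : v + w ≠ 0) :
    u.re * (pole v w).re + u.im * (pole v w).im =
      -1 + (‖u + v + w‖ ^ 2 - 1) / ‖v + w‖ ^ 2 := by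
  apply Complex.ofReal_injective
  rw [re_mul_re_add_im_mul_im, conj_pole hv hw hvw, pole]
  push_cast
  have hc : conj v + conj w ≠ 0 := by
    rw [← map_add]
    exact (map_ne_zero _).2 hvw
  rw [← Complex.mul_conj', ← Complex.mul_conj', map_add, map_add, map_add]
  have hu0 := ne_zero_of_norm_one hu
  have hv0 := ne_zero_of_norm_one hv
  have hw0 := ne_zero_of_norm_one hw
  have hu' : conj u = u⁻¹ := eq_inv_of_mul_eq_one_right (mul_conj_of_norm_one hu)
  have hv' : conj v = v⁻¹ := eq_inv_of_mul_eq_one_right (mul_conj_of_norm_one hv)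
  have hw' : conj w = w⁻¹ := eq_inv_of_mul_eq_one_right (mul_conj_of_norm_one hw)
  have hc' : v⁻¹ + w⁻¹ = (v + w) / (v * w) := by field_simp; ring
  rw [hu', hv', hw', add_assoc u⁻¹, hc']
  field_simp
  ring

/-! ### The conic condition on a chord and the closure condition for triangles. -/

/-- The tangency form of the equation of a conic. -/
def conicForm (p β : ℝ) (s u v : ℂ) : ℂ :=
  p * (u ^ 2 * v ^ 2 + 1) + β * (u * v) - conj s * (u * v * (u + v)) - s * (u + v) + (u + v) ^ 2

/-- Substitute `z = 2uv/(u+v)` and `conj z = 2/(u+v)` in the real equation of the conic and clear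
the denominator `(u+v)²`. -/
lemma conicForm_eq {p β : ℝ} {s u v : ℂ} (hu : ‖u‖ = 1) (hv : ‖v‖ = 1) (huv : u + v ≠ 0) :
    conicForm p β s u v = (u + v) ^ 2 / 4 *
      ((2 * p * ((pole u v).re ^ 2 - (pole u v).im ^ 2) + β * ((pole u v).re ^ 2 + (pole u v).im ^ 2)
        - 4 * (s.re * (pole u v).re + s.im * (pole u v).im) + 4 : ℝ) : ℂ) := by
  set z := pole u v with hz
  have h1 : ((2 * p * (z.re ^ 2 - z.im ^ 2) + β * (z.re ^ 2 + z.im ^ 2)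
      - 4 * (s.re * z.re + s.im * z.im) + 4 : ℝ) : ℂ) =
      p * (z ^ 2 + conj z ^ 2) + β * (z * conj z) - 2 * (s * conj z + conj s * z) + 4 := by
    apply Complex.ext <;> simp [pow_two] <;> ring
  rw [h1, hz, conj_pole hu hv huv, pole, conicForm]
  field_simp
  ring

lemma conicForm_eq_zero_iff {p β : ℝ} {s u v : ℂ} (hu : ‖u‖ = 1) (hv : ‖v‖ = 1)
    (huv : u + v ≠ 0) : conicForm p β s u v = 0 ↔
      2 * p * ((pole u v).re ^ 2 - (pole u v).im ^ 2) + β * ((pole u v).re ^ 2 + (pole u v).im ^ 2)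
        - 4 * (s.re * (pole u v).re + s.im * (pole u v).im) + 4 = 0 := by
  rw [conicForm_eq hu hv huv, mul_eq_zero, Complex.ofReal_eq_zero]
  exact or_iff_right (div_ne_zero (pow_ne_zero 2 huv) (by norm_num))

/-- The closure condition for triangles, together with the orthocentre of the contact triangle. -/
lemma closure_of_conicForm {p β : ℝ} {s u v w : ℂ} (hu : ‖u‖ = 1) (hv : ‖v‖ = 1) (hw : ‖w‖ = 1)
    (huv : u ≠ v) (hvw : v ≠ w) (huw : u ≠ w) (h1 : conicForm p β s u v = 0)
    (h2 : conicForm p β s v w = 0) (h3 : conicForm p β s w u = 0) :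
    u + v + w = s + p * (u * v * w) ∧ p ^ 2 + 1 + β = ‖s‖ ^ 2 := by
  -- With `u` fixed, `v` and `w` are roots of the same quadratic, so the difference of its values is
  -- divisible by `v - w`. Repeating this on `k1`, `k2` gives the symmetric relation `k3`.
  have k1 : p * (u ^ 2 * (v + w)) + β * u - conj s * (u ^ 2 + u * (v + w)) - s
      + (2 * u + v + w) = 0 := by
    apply mul_left_cancel₀ (sub_ne_zero.2 hvw)
    simp only [conicForm] at h1 h3
    linear_combination h1 - h3
  have k2 : p * (v ^ 2 * (w + u)) + β * v - conj s * (v ^ 2 + v * (w + u)) - s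
      + (2 * v + w + u) = 0 := by
    apply mul_left_cancel₀ (sub_ne_zero.2 huw)
    simp only [conicForm] at h1 h2
    linear_combination h1 - h2
  have k3 : p * (u * v + v * w + w * u) + β - conj s * (u + v + w) + 1 = 0 := by
    apply mul_left_cancel₀ (sub_ne_zero.2 huv)
    linear_combination k1 - k2
  have k4 : u + v + w = s + p * (u * v * w) := by
    linear_combination k1 - u * k3
  refine ⟨k4, ?_⟩
  have k5 := pairwise_mul_eq hu hv hw
  rw [k4, map_add, map_mul, Complex.conj_ofReal, map_mul, map_mul] at k5
  have k6 : u * v * w * (conj u * conj v * conj w) = 1 := by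
    rw [show u * v * w * (conj u * conj v * conj w) =
      (u * conj u) * (v * conj v) * (w * conj w) by ring, mul_conj_of_norm_one hu,
      mul_conj_of_norm_one hv, mul_conj_of_norm_one hw]
    ring
  apply Complex.ofReal_injective
  push_cast
  rw [← Complex.mul_conj']
  linear_combination k3 - p * k5 - p ^ 2 * k6 + conj s * k4

/-- Converse of `closure_of_conicForm`: the closure condition and its conjugate express the first
two symmetric functions through `uvw`, and `w * conicForm` is a combination of these relations. This
is the porism half of the argument. -/
lemma conicForm_eq_zero_of_closure {p β : ℝ} {s u v w : ℂ} (hu : ‖u‖ = 1) (hv : ‖v‖ = 1)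
    (hw : ‖w‖ = 1) (h : u + v + w = s + p * (u * v * w)) (hβ : p ^ 2 + 1 + β = ‖s‖ ^ 2) :
    conicForm p β s u v = 0 := by
  have k5 := pairwise_mul_eq hu hv hw
  rw [h, map_add, map_mul, Complex.conj_ofReal, map_mul, map_mul] at k5
  have k6 : u * v * w * (conj u * conj v * conj w) = 1 := by
    rw [show u * v * w * (conj u * conj v * conj w) =
      (u * conj u) * (v * conj v) * (w * conj w) by ring, mul_conj_of_norm_one hu,
      mul_conj_of_norm_one hv, mul_conj_of_norm_one hw]
    ring
  have k7 : u * v + v * w + w * u = u * v * w * conj s + p := by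
    linear_combination k5 + p * k6
  have hβ' := congrArg (Complex.ofReal) hβ
  push_cast at hβ'
  rw [← Complex.mul_conj'] at hβ'
  apply mul_left_cancel₀ (ne_zero_of_norm_one hw)
  rw [mul_zero, conicForm]
  have e1 : (p : ℂ) ^ 2 + 1 + β - s * conj s = 0 := by linear_combination hβ'
  linear_combination (u * v * w) * e1 + (p - u * v) * h + (u + v - s) * k7

/-! ### Passage between the plane and `ℂ`; contact triangles. -/

/-- The point with complex coordinate `z` in the frame with origin `C` and unit length `r`. -/
noncomputable def pt (C : Plane) (r : ℝ) (z : ℂ) : Plane := !₂[C 0 + r * z.re, C 1 + r * z.im]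

@[simp] lemma pt_apply_zero (C : Plane) (r : ℝ) (z : ℂ) : pt C r z 0 = C 0 + r * z.re := rfl

@[simp] lemma pt_apply_one (C : Plane) (r : ℝ) (z : ℂ) : pt C r z 1 = C 1 + r * z.im := rfl

lemma plane_ext {P Q : Plane} (h0 : P 0 = Q 0) (h1 : P 1 = Q 1) : P = Q := by
  ext i
  fin_cases i
  · exact h0
  · exact h1

@[simp] lemma pt_zero (C : Plane) (r : ℝ) : pt C r 0 = C := plane_ext (by simp) (by simp)

lemma dist_pt (C : Plane) {r : ℝ} (hr : 0 ≤ r) (z z' : ℂ) :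
    dist (pt C r z) (pt C r z') = r * ‖z - z'‖ := by
  rw [dist_eq_norm, ← sq_eq_sq₀ (norm_nonneg _) (by positivity), norm_sq_plane, mul_pow,
    ← Complex.normSq_eq_norm_sq, Complex.normSq_apply]
  simp
  ring

lemma exists_eq_pt (C : Plane) {r : ℝ} (hr : r ≠ 0) (P : Plane) : ∃ z, P = pt C r z := by
  refine ⟨⟨(P 0 - C 0) / r, (P 1 - C 1) / r⟩, plane_ext ?_ ?_⟩
  · simp only [pt_apply_zero]
    field_simp
    ring
  · simp only [pt_apply_one]
    field_simp
    ring

/-- The vector of the plane with complex coordinate `z`. -/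
noncomputable def vec (z : ℂ) : Plane := !₂[z.re, z.im]

@[simp] lemma vec_apply_zero (z : ℂ) : vec z 0 = z.re := rfl

@[simp] lemma vec_apply_one (z : ℂ) : vec z 1 = z.im := rfl

lemma exists_eq_vec (n : Plane) : ∃ z, n = vec z := ⟨⟨n 0, n 1⟩, plane_ext rfl rfl⟩

lemma norm_vec (z : ℂ) : ‖vec z‖ = ‖z‖ := by
  rw [← sq_eq_sq₀ (norm_nonneg _) (norm_nonneg _), norm_sq_plane,
    ← Complex.normSq_eq_norm_sq, Complex.normSq_apply]
  simp
  ring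

lemma inner_vec_pt_sub (C : Plane) (r : ℝ) (u z : ℂ) :
    ⟪vec u, pt C r z - C⟫ = r * (u.re * z.re + u.im * z.im) := by
  rw [inner_plane]
  simp
  ring

/-- The vertices of the triangle `T` are the poles of the sides of the triangle `u`, `v`, `w`
inscribed in the circle with centre `C` and radius `r`. -/
def HasContact (C : Plane) (r : ℝ) (T : Affine.Triangle ℝ Plane) (u v w : ℂ) : Prop :=
  T.points 0 = pt C r (pole v w) ∧ T.points 1 = pt C r (pole w u) ∧ T.points 2 = pt C r (pole u v)

/-- The contact triangle of a triangle with a given incircle, which is acute. -/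
lemma exists_hasContact {T : Affine.Triangle ℝ Plane} {C : Plane} {r : ℝ}
    (h : T.insphere = ⟨C, r⟩) :
    ∃ u v w : ℂ, ‖u‖ = 1 ∧ ‖v‖ = 1 ∧ ‖w‖ = 1 ∧ ‖u + v + w‖ < 1 ∧ HasContact C r T u v w := by
  obtain ⟨hr, n, -, hn, hT, hT', -, -, -⟩ := exists_normals_of_insphere h
  choose N hN using fun i ↦ exists_eq_vec (n i)
  choose z hz using fun i ↦ exists_eq_pt C hr.ne' (T.points i)
  have hN1 (i) : ‖N i‖ = 1 := by rw [← norm_vec, ← hN, hn]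
  have hin (i j) (hij : j ≠ i) : (N i).re * (z j).re + (N i).im * (z j).im = 1 := by
    have := hT i j hij
    rw [hN, hz, inner_vec_pt_sub] at this
    exact mul_left_cancel₀ hr.ne' (by rw [this, mul_one])
  have hin' (i) : (N i).re * (z i).re + (N i).im * (z i).im < -1 := by
    have := hT' i
    rw [hN, hz, inner_vec_pt_sub] at this
    by_contra! hcon
    nlinarith [mul_le_mul_of_nonneg_left hcon hr.le]
  have hne (i j) (hij : j ≠ i) : N i ≠ N j := by
    intro he
    have h1 := hin i j hij
    have h2 := hin' j
    rw [← he, h1] at h2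
    norm_num at h2
  have hpole (i j k) (hij : i ≠ j) (hki : k ≠ i) (hkj : k ≠ j) :
      N i + N j ≠ 0 ∧ z k = pole (N i) (N j) :=
    eq_pole (hN1 i) (hN1 j) (hne i j hij.symm) (hin i k hki) (hin j k hkj)
  obtain ⟨h0, hpoleA⟩ := hpole 1 2 0 (by decide) (by decide) (by decide)
  obtain ⟨-, hpoleB⟩ := hpole 2 0 1 (by decide) (by decide) (by decide)
  obtain ⟨-, hpoleC⟩ := hpole 0 1 2 (by decide) (by decide) (by decide)
  refine ⟨N 0, N 1, N 2, hN1 0, hN1 1, hN1 2, ?_, ?_, ?_, ?_⟩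
  -- By `inner_pole_opposite` the functional is below `-1` at the opposite pole only if the
  -- orthocentre lies in the open unit disc.
  · have h3 := hin' 0
    rw [hpoleA, inner_pole_opposite (hN1 0) (hN1 1) (hN1 2) h0] at h3
    by_contra! hcon
    have h4 : 0 ≤ (‖N 0 + N 1 + N 2‖ ^ 2 - 1) / ‖N 1 + N 2‖ ^ 2 :=
      div_nonneg (by nlinarith) (by positivity)
    linarith
  · rw [hz, hpoleA]
  · rw [hz, hpoleB]
  · rw [hz, hpoleC]

/-- The barycentric weight of the incentre of a triangle at the vertex opposite to the point of
contact `u`. -/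
noncomputable def contactWeight (u v w : ℂ) : ℝ :=
  1 / (2 + (1 - ‖u + v + w‖ ^ 2) / ‖v + w‖ ^ 2)

lemma contactWeight_pos {u v w : ℂ} (h : ‖u + v + w‖ < 1) : 0 < contactWeight u v w := by
  have : 0 < 1 - ‖u + v + w‖ ^ 2 := by nlinarith [norm_nonneg (u + v + w)]
  unfold contactWeight
  positivity

/-- In this rational form the barycentric relations between the three weights become field
identities in `u`, `v`, `w`. -/
lemma contactWeight_eq {u v w : ℂ} (hu : ‖u‖ = 1) (hv : ‖v‖ = 1) (hw : ‖w‖ = 1)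
    (h : ‖u + v + w‖ < 1) :
    (contactWeight u v w : ℂ) = -(u * (v + w)) / ((u - v) * (u - w)) := by
  have hvw : v + w ≠ 0 := add_ne_zero_of_norm_lt hu (by rwa [show v + w + u = u + v + w by ring])
  have huv : u - v ≠ 0 := sub_ne_zero.2 (ne_of_norm_lt hu hw h)
  have huw : u - w ≠ 0 := sub_ne_zero.2
    (ne_of_norm_lt hu hv (by rwa [show u + w + v = u + v + w by ring]))
  have h1 := inner_pole_opposite hu hv hw hvw
  have h2 : contactWeight u v w = 1 / (1 - (u.re * (pole v w).re + u.im * (pole v w).im)) := by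
    rw [h1, contactWeight]
    congr 1
    ring
  rw [h2]
  have hu0 := ne_zero_of_norm_one hu
  have hu' : conj u = u⁻¹ := eq_inv_of_mul_eq_one_right (mul_conj_of_norm_one hu)
  have h3 : (1 : ℂ) - ((u.re * (pole v w).re + u.im * (pole v w).im : ℝ) : ℂ) =
      -((u - v) * (u - w)) / (u * (v + w)) := by
    rw [re_mul_re_add_im_mul_im, conj_pole hv hw hvw, pole, hu']
    field_simp
    ring
  rw [Complex.ofReal_div, Complex.ofReal_sub, Complex.ofReal_one, h3]
  field_simp

/-- Converse of `exists_hasContact`. Since the orthocentre is inside the unit circle, the weights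
are positive and the circle is the incircle, not an excircle. -/
lemma exists_triangle_hasContact (C : Plane) {r : ℝ} (hr : 0 < r) {u v w : ℂ} (hu : ‖u‖ = 1)
    (hv : ‖v‖ = 1) (hw : ‖w‖ = 1) (h : ‖u + v + w‖ < 1) :
    ∃ T : Affine.Triangle ℝ Plane, HasContact C r T u v w ∧ T.insphere = ⟨C, r⟩ := by
  have hvw' : ‖v + w + u‖ < 1 := by rwa [show v + w + u = u + v + w by ring]
  have hwu' : ‖w + u + v‖ < 1 := by rwa [show w + u + v = u + v + w by ring]
  have huv : u + v ≠ 0 := add_ne_zero_of_norm_lt hw h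
  have hvw : v + w ≠ 0 := add_ne_zero_of_norm_lt hu hvw'
  have hwu : w + u ≠ 0 := add_ne_zero_of_norm_lt hv hwu'
  have huv0 : u - v ≠ 0 := sub_ne_zero.2 (ne_of_norm_lt hu hw h)
  have hvw0 : v - w ≠ 0 := sub_ne_zero.2 (ne_of_norm_lt hv hu hvw')
  have hwu0 : w - u ≠ 0 := sub_ne_zero.2 (ne_of_norm_lt hw hv hwu')
  let P : Fin 3 → Plane := ![pt C r (pole v w), pt C r (pole w u), pt C r (pole u v)]
  let n : Fin 3 → Plane := ![vec u, vec v, vec w]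
  let W : Fin 3 → ℝ := ![contactWeight u v w, contactWeight v w u, contactWeight w u v]
  have hn (i) : ‖n i‖ = 1 := by
    fin_cases i <;> simpa [n, norm_vec]
  have hnP (i j) (hij : j ≠ i) : ⟪n i, P j - C⟫ = r := by
    have key (x y : ℂ) (hx : ‖x‖ = 1) (hy : ‖y‖ = 1) (hxy : x + y ≠ 0) :
        ⟪vec x, pt C r (pole x y) - C⟫ = r ∧ ⟪vec y, pt C r (pole x y) - C⟫ = r := by
      rw [inner_vec_pt_sub, inner_vec_pt_sub, inner_pole hx hy hxy, pole_comm,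
        inner_pole hy hx (by rwa [add_comm])]
      simp
    fin_cases i <;> fin_cases j <;> first | exact absurd rfl hij | skip
    · exact (key w u hw hu hwu).2
    · exact (key u v hu hv huv).1
    · exact (key v w hv hw hvw).1
    · exact (key u v hu hv huv).2
    · exact (key v w hv hw hvw).2
    · exact (key w u hw hu hwu).1
  have hnP' (i) : ⟪n i, P i - C⟫ ≠ r := by
    have key (x y z : ℂ) (hx : ‖x‖ = 1) (hy : ‖y‖ = 1) (hz : ‖z‖ = 1) (hyz : y + z ≠ 0)
        (hxyz : ‖x + y + z‖ < 1) : ⟪vec x, pt C r (pole y z) - C⟫ ≠ r := by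
      rw [inner_vec_pt_sub, inner_pole_opposite hx hy hz hyz]
      have h1 : (‖x + y + z‖ ^ 2 - 1) / ‖y + z‖ ^ 2 ≤ 0 :=
        div_nonpos_of_nonpos_of_nonneg (by nlinarith [norm_nonneg (x + y + z)]) (by positivity)
      nlinarith
    fin_cases i
    · exact key u v w hu hv hw hvw h
    · exact key v w u hv hw hu hwu hvw'
    · exact key w u v hw hu hv huv hwu'
  have hW (i) : 0 < W i := by
    fin_cases i
    · exact contactWeight_pos h
    · exact contactWeight_pos hvw'
    · exact contactWeight_pos hwu'
  have e1 := contactWeight_eq hu hv hw h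
  have e2 := contactWeight_eq hv hw hu hvw'
  have e3 := contactWeight_eq hw hu hv hwu'
  have huw0 : u - w ≠ 0 := by rwa [← neg_sub, neg_ne_zero]
  have hvu0 : v - u ≠ 0 := by rwa [← neg_sub, neg_ne_zero]
  have hwv0 : w - v ≠ 0 := by rwa [← neg_sub, neg_ne_zero]
  have hsum : contactWeight u v w + contactWeight v w u + contactWeight w u v = 1 := by
    apply Complex.ofReal_injective
    push_cast
    rw [e1, e2, e3]
    rw [← neg_sub w u, ← neg_sub u v, ← neg_sub v w]
    field_simp
    ring
  have hpole : (contactWeight u v w : ℂ) * pole v w + contactWeight v w u * pole w u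
      + contactWeight w u v * pole u v = 0 := by
    rw [e1, e2, e3, pole, pole, pole]
    rw [← neg_sub w u, ← neg_sub u v, ← neg_sub v w]
    field_simp
    ring
  have hre := congrArg Complex.re hpole
  have him := congrArg Complex.im hpole
  simp only [Complex.add_re, Complex.re_ofReal_mul, Complex.zero_re] at hre
  simp only [Complex.add_im, Complex.im_ofReal_mul, Complex.zero_im] at him
  have hW1 : ∑ i, W i = 1 := by
    rw [Fin.sum_univ_three]
    exact hsum
  have hWC : ∑ i, W i • P i = C := by
    rw [Fin.sum_univ_three]
    refine plane_ext ?_ ?_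
    · simp [W, P]
      linear_combination C 0 * hsum + r * hre
    · simp [W, P]
      linear_combination C 1 * hsum + r * him
  exact ⟨⟨P, affineIndependent_of_normals hnP hnP'⟩, ⟨rfl, rfl, rfl⟩,
    insphere_eq_of_normals hr n W hn hnP hW hW1 hWC⟩

/-! ### The circumcircle and `X36` in terms of the contact triangle. -/

lemma norm_sq_sub_one_eq {u v w : ℂ} (hu : ‖u‖ = 1) (hv : ‖v‖ = 1) (hw : ‖w‖ = 1) :
    ((‖u + v + w‖ ^ 2 - 1 : ℝ) : ℂ) * (u * v * w) = (u + v) * (v + w) * (w + u) := by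
  push_cast
  rw [← Complex.mul_conj']
  linear_combination -(u + v + w) * pairwise_mul_eq hu hv hw

/-- With `h = u+v+w`, the difference is `2/(‖h‖²-1) * (vw/u)`, whose modulus is the same for all
three poles. Geometrically, inversion in the incircle carries the circumcircle to the nine-point
circle of the contact triangle. -/
lemma norm_pole_sub {u v w : ℂ} (hu : ‖u‖ = 1) (hv : ‖v‖ = 1) (hw : ‖w‖ = 1)
    (h : ‖u + v + w‖ < 1) :
    ‖pole v w - ((2 / (‖u + v + w‖ ^ 2 - 1) : ℝ) : ℂ) * (u + v + w)‖ =
      2 / (1 - ‖u + v + w‖ ^ 2) := by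
  have h0 : 0 < 1 - ‖u + v + w‖ ^ 2 := by nlinarith [norm_nonneg (u + v + w)]
  have hvw : v + w ≠ 0 := add_ne_zero_of_norm_lt hu (by rwa [show v + w + u = u + v + w by ring])
  have h1 := norm_sq_sub_one_eq hu hv hw
  have hm : ((‖u + v + w‖ ^ 2 - 1 : ℝ) : ℂ) ≠ 0 := by
    rw [Complex.ofReal_ne_zero]
    linarith
  have h2 : pole v w - ((2 / (‖u + v + w‖ ^ 2 - 1) : ℝ) : ℂ) * (u + v + w) =
      ((2 / (‖u + v + w‖ ^ 2 - 1) : ℝ) : ℂ) * (v * w / u) := by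
    rw [Complex.ofReal_div, pole]
    have hu0 := ne_zero_of_norm_one hu
    set m := ((‖u + v + w‖ ^ 2 - 1 : ℝ) : ℂ)
    push_cast
    field_simp
    linear_combination h1
  rw [h2, norm_mul, norm_div, norm_mul, hu, hv, hw, Complex.norm_real, Real.norm_eq_abs,
    ← abs_neg, ← div_neg, neg_sub, abs_of_pos (by positivity)]
  norm_num

lemma hasContact_circumcenter {C : Plane} {r : ℝ} (hr : 0 < r) {T : Affine.Triangle ℝ Plane}
    {u v w : ℂ} (hu : ‖u‖ = 1) (hv : ‖v‖ = 1) (hw : ‖w‖ = 1) (h : ‖u + v + w‖ < 1)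
    (hT : HasContact C r T u v w) :
    T.circumcenter = pt C r (((2 / (‖u + v + w‖ ^ 2 - 1) : ℝ) : ℂ) * (u + v + w)) ∧
      T.circumradius = r * (2 / (1 - ‖u + v + w‖ ^ 2)) := by
  have hspan : affineSpan ℝ (Set.range T.points) = ⊤ := by
    rw [T.independent.affineSpan_eq_top_iff_card_eq_finrank_add_one]
    simp
  have hdist (i) : dist (T.points i)
      (pt C r (((2 / (‖u + v + w‖ ^ 2 - 1) : ℝ) : ℂ) * (u + v + w))) =
      r * (2 / (1 - ‖u + v + w‖ ^ 2)) := by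
    have hvwu : v + w + u = u + v + w := by ring
    have hwuv : w + u + v = u + v + w := by ring
    fin_cases i
    · change dist (T.points 0) _ = _
      rw [hT.1, dist_pt C hr.le, norm_pole_sub hu hv hw h]
    · change dist (T.points 1) _ = _
      have := norm_pole_sub hv hw hu (by rwa [hvwu])
      rw [hvwu] at this
      rw [hT.2.1, dist_pt C hr.le, this]
    · change dist (T.points 2) _ = _
      have := norm_pole_sub hw hu hv (by rwa [hwuv])
      rw [hwuv] at this
      rw [hT.2.2, dist_pt C hr.le, this]
  have hmem : pt C r (((2 / (‖u + v + w‖ ^ 2 - 1) : ℝ) : ℂ) * (u + v + w)) ∈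
      affineSpan ℝ (Set.range T.points) := by
    rw [hspan]
    trivial
  exact ⟨(T.eq_circumcenter_of_dist_eq hmem hdist).symm,
    (T.eq_circumradius_of_dist_eq hmem hdist).symm⟩

lemma incenter_eq_of_insphere {T : Affine.Triangle ℝ Plane} {C : Plane} {r : ℝ}
    (h : T.insphere = ⟨C, r⟩) : T.incenter = C := by
  simpa using congrArg EuclideanGeometry.Sphere.center h

lemma incenter_ne_circumcenter {C : Plane} {r : ℝ} (hr : 0 < r) {T : Affine.Triangle ℝ Plane}
    {u v w : ℂ} (hu : ‖u‖ = 1) (hv : ‖v‖ = 1) (hw : ‖w‖ = 1) (h : ‖u + v + w‖ < 1)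
    (h0 : u + v + w ≠ 0) (hT : HasContact C r T u v w) (hC : T.incenter = C) :
    T.incenter ≠ T.circumcenter := by
  have hm : 0 < 1 - ‖u + v + w‖ ^ 2 := by nlinarith [norm_nonneg (u + v + w)]
  intro he
  rw [hC, (hasContact_circumcenter hr hu hv hw h hT).1] at he
  have hd := dist_pt C hr.le (((2 / (‖u + v + w‖ ^ 2 - 1) : ℝ) : ℂ) * (u + v + w)) 0
  rw [← he, pt_zero, dist_self, sub_zero, eq_comm, mul_eq_zero, or_iff_right hr.ne',
    norm_eq_zero, mul_eq_zero, or_iff_left h0, Complex.ofReal_eq_zero] at hd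
  refine (div_ne_zero two_ne_zero ?_) hd
  linarith

/-- `X₃₆` is the inverse in the incircle of the nine-point centre of the contact triangle. -/
lemma X36_eq {C : Plane} {r : ℝ} (hr : 0 < r) {T : Affine.Triangle ℝ Plane}
    {u v w : ℂ} (hu : ‖u‖ = 1) (hv : ‖v‖ = 1) (hw : ‖w‖ = 1) (h : ‖u + v + w‖ < 1)
    (h0 : u + v + w ≠ 0) (hT : HasContact C r T u v w) (hC : T.incenter = C) :
    X36 T = pt C r (((2 / ‖u + v + w‖ ^ 2 : ℝ) : ℂ) * (u + v + w)) := by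
  obtain ⟨hO, hR⟩ := hasContact_circumcenter hr hu hv hw h hT
  have hm : 0 < 1 - ‖u + v + w‖ ^ 2 := by nlinarith [norm_nonneg (u + v + w)]
  have hm' : ‖u + v + w‖ ^ 2 - 1 ≠ 0 := by linarith
  have hd := dist_pt C hr.le 0 (((2 / (‖u + v + w‖ ^ 2 - 1) : ℝ) : ℂ) * (u + v + w))
  have hN : 0 < ‖u + v + w‖ := norm_pos_iff.2 h0
  rw [pt_zero, zero_sub, norm_neg, norm_mul, Complex.norm_real, Real.norm_eq_abs, ← abs_neg,
    ← div_neg, neg_sub, abs_of_pos (by positivity)] at hd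
  rw [X36, hO, hR, hC, EuclideanGeometry.inversion, hd]
  -- The circumradius divided by the distance between circumcenter and incenter is `1/‖h‖`, so the
  -- inversion scales the vector between them by `1/‖h‖²`.
  have hk : r * (2 / (1 - ‖u + v + w‖ ^ 2)) / (r * (2 / (1 - ‖u + v + w‖ ^ 2) * ‖u + v + w‖)) =
      1 / ‖u + v + w‖ := by
    field_simp
  rw [hk]
  set N := ‖u + v + w‖
  refine plane_ext ?_ ?_
  · simp only [vsub_eq_sub, vadd_eq_add, PiLp.add_apply, PiLp.smul_apply, PiLp.sub_apply,
      pt_apply_zero, Complex.re_ofReal_mul, smul_eq_mul]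
    field_simp
    ring
  · simp only [vsub_eq_sub, vadd_eq_add, PiLp.add_apply, PiLp.smul_apply, PiLp.sub_apply,
      pt_apply_one, Complex.im_ofReal_mul, smul_eq_mul]
    field_simp
    ring

/-! ### The ellipse in the frame of the incircle. -/

/-- Minus the power of `[x, y]` with respect to the ellipse, cleared of denominators. -/
def ellipsePower (a b x y : ℝ) : ℝ := a ^ 2 * b ^ 2 - b ^ 2 * x ^ 2 - a ^ 2 * y ^ 2

/-- The product of the foci of the polar conic of the ellipse in the incircle. -/
noncomputable def fociProd (a b x y r : ℝ) : ℝ := r ^ 2 * csq a b / ellipsePower a b x y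

/-- The sum of the foci of the polar conic of the ellipse in the incircle. -/
noncomputable def fociSum (a b x y r : ℝ) : ℂ :=
  ⟨2 * r * b ^ 2 * x / ellipsePower a b x y, 2 * r * a ^ 2 * y / ellipsePower a b x y⟩

/-- The coefficient of `z * conj z` in the equation of the ellipse in the frame of the incircle. -/
noncomputable def conicCoeff (a b x y r : ℝ) : ℝ :=
  -(2 * r ^ 2 * (a ^ 2 + b ^ 2)) / ellipsePower a b x y

lemma mem_ellipse_iff {a b : ℝ} (ha : a ≠ 0) (hb : b ≠ 0) (P : Plane) :
    P ∈ ellipse a b ↔ b ^ 2 * P 0 ^ 2 + a ^ 2 * P 1 ^ 2 = a ^ 2 * b ^ 2 := by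
  rw [ellipse, Set.mem_ofPred_eq, div_add_div _ _ (pow_ne_zero 2 ha) (pow_ne_zero 2 hb),
    div_eq_one_iff_eq (by positivity)]
  constructor <;> intro h <;> linear_combination h

/-- The factor `-4 / ellipsePower` normalises the constant term to `4`, as `conicForm` requires. -/
lemma pt_mem_ellipse_iff {a b x y r : ℝ} (ha : a ≠ 0) (hb : b ≠ 0) (hG : ellipsePower a b x y ≠ 0)
    (z : ℂ) : pt !₂[x, y] r z ∈ ellipse a b ↔
      2 * fociProd a b x y r * (z.re ^ 2 - z.im ^ 2)
        + conicCoeff a b x y r * (z.re ^ 2 + z.im ^ 2)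
        - 4 * ((fociSum a b x y r).re * z.re + (fociSum a b x y r).im * z.im) + 4 = 0 := by
  have key : 2 * fociProd a b x y r * (z.re ^ 2 - z.im ^ 2)
        + conicCoeff a b x y r * (z.re ^ 2 + z.im ^ 2)
        - 4 * ((fociSum a b x y r).re * z.re + (fociSum a b x y r).im * z.im) + 4 =
      -4 / ellipsePower a b x y *
        (b ^ 2 * (x + r * z.re) ^ 2 + a ^ 2 * (y + r * z.im) ^ 2 - a ^ 2 * b ^ 2) := by
    simp only [fociProd, conicCoeff, fociSum, csq]
    field_simp
    simp only [ellipsePower]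
    ring
  rw [key, mul_eq_zero, or_iff_right (div_ne_zero (by norm_num) hG), mem_ellipse_iff ha hb,
    sub_eq_zero]
  simp

/-- The centre is a convex combination of points of the ellipse, so the defect in the quadratic form
is the weighted sum of its values at vertex minus centre. -/
lemma ellipsePower_pos {a b x y r : ℝ} (ha : 0 < a) (hb : 0 < b) {T : Affine.Triangle ℝ Plane}
    (hT : T ∈ family a b !₂[x, y] r) : 0 < ellipsePower a b x y := by
  obtain ⟨hE, hI⟩ := hT
  obtain ⟨hr, n, w, -, hn, -, hw, hw1, hwC⟩ := exists_normals_of_insphere hI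
  have hE' (i) := (mem_ellipse_iff ha.ne' hb.ne' _).1 (hE i)
  have hx := congrArg (fun P : Plane ↦ P 0) hwC
  have hy := congrArg (fun P : Plane ↦ P 1) hwC
  simp only [Fin.sum_univ_three, PiLp.add_apply, PiLp.smul_apply, smul_eq_mul] at hx hy
  rw [Fin.sum_univ_three] at hw1
  simp at hx hy
  have hsum : ellipsePower a b x y = ∑ i, w i * (b ^ 2 * (T.points i 0 - x) ^ 2
      + a ^ 2 * (T.points i 1 - y) ^ 2) := by
    rw [Fin.sum_univ_three, ellipsePower]
    linear_combination -w 0 * hE' 0 - w 1 * hE' 1 - w 2 * hE' 2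
      + 2 * b ^ 2 * x * hx + 2 * a ^ 2 * y * hy
      - (a ^ 2 * b ^ 2 + b ^ 2 * x ^ 2 + a ^ 2 * y ^ 2) * hw1
  rw [hsum]
  have hnn (i) : 0 ≤ b ^ 2 * (T.points i 0 - x) ^ 2 + a ^ 2 * (T.points i 1 - y) ^ 2 := by
    positivity
  refine Finset.sum_pos' (fun i _ ↦ mul_nonneg (hw i).le (hnn i)) ⟨0, Finset.mem_univ _, ?_⟩
  refine mul_pos (hw 0) ((hnn 0).lt_of_ne fun h0 ↦ ?_)
  have h0x : T.points 0 0 - x = 0 := by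
    by_contra hne
    have : 0 < b ^ 2 * (T.points 0 0 - x) ^ 2 := by positivity
    have : 0 ≤ a ^ 2 * (T.points 0 1 - y) ^ 2 := by positivity
    linarith
  have h0y : T.points 0 1 - y = 0 := by
    by_contra hne
    have : 0 < a ^ 2 * (T.points 0 1 - y) ^ 2 := by positivity
    have : 0 ≤ b ^ 2 * (T.points 0 0 - x) ^ 2 := by positivity
    linarith
  have h1 := hn 1 0 (by decide)
  rw [inner_plane] at h1
  simp [h0x, h0y] at h1
  exact hr.ne h1

/-- The orthocentres of the contact triangles lie on a fixed circle. -/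
lemma closure_of_mem_family {a b x y r : ℝ} (ha : 0 < a) (hb : 0 < b)
    {T : Affine.Triangle ℝ Plane} (hT : T ∈ family a b !₂[x, y] r) {u v w : ℂ}
    (hu : ‖u‖ = 1) (hv : ‖v‖ = 1) (hw : ‖w‖ = 1) (h : ‖u + v + w‖ < 1)
    (hc : HasContact !₂[x, y] r T u v w) :
    u + v + w = fociSum a b x y r + fociProd a b x y r * (u * v * w) ∧
      fociProd a b x y r ^ 2 + 1 + conicCoeff a b x y r = ‖fociSum a b x y r‖ ^ 2 := by
  have hG := (ellipsePower_pos ha hb hT).ne'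
  have hvw' : ‖v + w + u‖ < 1 := by rwa [show v + w + u = u + v + w by ring]
  have hwu' : ‖w + u + v‖ < 1 := by rwa [show w + u + v = u + v + w by ring]
  have key (u v : ℂ) (hu : ‖u‖ = 1) (hv : ‖v‖ = 1) (huv : u + v ≠ 0) (i : Fin 3)
      (hi : T.points i = pt !₂[x, y] r (pole u v)) :
      conicForm (fociProd a b x y r) (conicCoeff a b x y r) (fociSum a b x y r) u v = 0 := by
    rw [conicForm_eq_zero_iff hu hv huv, ← pt_mem_ellipse_iff ha.ne' hb.ne' hG, ← hi]
    exact hT.1 i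
  exact closure_of_conicForm hu hv hw (ne_of_norm_lt hu hw h) (ne_of_norm_lt hv hu hvw')
    (ne_of_norm_lt hw hv hwu').symm (key u v hu hv (add_ne_zero_of_norm_lt hw h) 2 hc.2.2)
    (key v w hv hw (add_ne_zero_of_norm_lt hu hvw') 0 hc.1)
    (key w u hw hu (add_ne_zero_of_norm_lt hv hwu') 1 hc.2.1)

lemma mem_family_of_closure {a b x y r : ℝ} (ha : 0 < a) (hb : 0 < b)
    (hG : ellipsePower a b x y ≠ 0) {T : Affine.Triangle ℝ Plane}
    (hT : T.insphere = ⟨!₂[x, y], r⟩) {u v w : ℂ}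
    (hu : ‖u‖ = 1) (hv : ‖v‖ = 1) (hw : ‖w‖ = 1) (h : ‖u + v + w‖ < 1)
    (hc : HasContact !₂[x, y] r T u v w)
    (hs : u + v + w = fociSum a b x y r + fociProd a b x y r * (u * v * w))
    (hβ : fociProd a b x y r ^ 2 + 1 + conicCoeff a b x y r = ‖fociSum a b x y r‖ ^ 2) :
    T ∈ family a b !₂[x, y] r := by
  have hvwu : v + w + u = u + v + w := by ring
  have hwuv : w + u + v = u + v + w := by ring
  have key (u v w : ℂ) (hu : ‖u‖ = 1) (hv : ‖v‖ = 1) (hw : ‖w‖ = 1) (h : ‖u + v + w‖ < 1)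
      (hs : u + v + w = fociSum a b x y r + fociProd a b x y r * (u * v * w)) :
      pt !₂[x, y] r (pole u v) ∈ ellipse a b := by
    rw [pt_mem_ellipse_iff ha.ne' hb.ne' hG,
      ← conicForm_eq_zero_iff hu hv (add_ne_zero_of_norm_lt hw h)]
    exact conicForm_eq_zero_of_closure hu hv hw hs hβ
  refine ⟨fun i ↦ ?_, hT⟩
  fin_cases i
  · change T.points 0 ∈ _
    rw [hc.1]
    exact key v w u hv hw hu (by rwa [hvwu]) (by rw [hvwu, hs]; ring)
  · change T.points 1 ∈ _
    rw [hc.2.1]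
    exact key w u v hw hu hv (by rwa [hwuv]) (by rw [hwuv, hs]; ring)
  · change T.points 2 ∈ _
    rw [hc.2.2]
    exact key u v w hu hv hw h hs

/-! ### The circle of orthocentres: its size and its inverse. -/

lemma norm_fociSum_lt {a b x y r : ℝ} (hb : 0 < b) (hr : 0 < r)
    (hG : 0 < ellipsePower a b x y)
    (hβ : fociProd a b x y r ^ 2 + 1 + conicCoeff a b x y r = ‖fociSum a b x y r‖ ^ 2) :
    ‖fociSum a b x y r‖ < |1 - fociProd a b x y r| := by
  rw [← abs_norm, ← sq_lt_sq, ← hβ]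
  have h1 : 2 * fociProd a b x y r + conicCoeff a b x y r =
      -(4 * r ^ 2 * b ^ 2 / ellipsePower a b x y) := by
    rw [fociProd, conicCoeff, csq]
    field_simp
    ring
  have h2 : 0 < 4 * r ^ 2 * b ^ 2 / ellipsePower a b x y := by positivity
  linarith

/-- If `p ≥ 1`, then `‖s‖ < p - 1` and `p ≤ ‖s + pε‖ + ‖s‖ < p`. One triangle of the family thus
yields `‖s‖ + p < 1`. -/
lemma lt_one_of_norm_lt {p : ℝ} (hp : 0 < p) {s ε : ℂ} (hs : ‖s‖ < |1 - p|) (hε : ‖ε‖ = 1)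
    (h : ‖s + p * ε‖ < 1) : p < 1 := by
  by_contra! hp1
  rw [abs_of_nonpos (by linarith)] at hs
  have h1 : ‖(p : ℂ) * ε‖ ≤ ‖s + p * ε‖ + ‖s‖ := by
    simpa using norm_sub_le (s + p * ε) s
  rw [norm_mul, hε, Complex.norm_of_nonneg hp.le] at h1
  linarith

/-- The circle with centre `s` and radius `p` and its image under `h ↦ 2 h / ‖h‖²`. -/
lemma norm_inverse_sub {p : ℝ} {s h : ℂ} (hm : ‖s‖ ^ 2 - p ^ 2 ≠ 0) (hp : 0 < p) (h0 : h ≠ 0) :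
    ‖((2 / ‖h‖ ^ 2 : ℝ) : ℂ) * h - ((2 / (‖s‖ ^ 2 - p ^ 2) : ℝ) : ℂ) * s‖ =
      2 * p / |‖s‖ ^ 2 - p ^ 2| ↔ ‖h - s‖ = p := by
  have hN : ‖h‖ ^ 2 ≠ 0 := pow_ne_zero 2 (norm_ne_zero_iff.2 h0)
  rw [← sq_eq_sq₀ (norm_nonneg _) (by positivity), ← sq_eq_sq₀ (norm_nonneg (h - s)) hp.le,
    div_pow, sq_abs, ← sub_eq_zero, ← sub_eq_zero (a := ‖h - s‖ ^ 2)]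
  have hhN : h.re ^ 2 + h.im ^ 2 = ‖h‖ ^ 2 := by
    rw [← Complex.normSq_eq_norm_sq, Complex.normSq_apply]
    ring
  have hsN : s.re ^ 2 + s.im ^ 2 = ‖s‖ ^ 2 := by
    rw [← Complex.normSq_eq_norm_sq, Complex.normSq_apply]
    ring
  -- The two circle equations are proportional with a nonzero factor, so they vanish together.
  have key : ‖((2 / ‖h‖ ^ 2 : ℝ) : ℂ) * h - ((2 / (‖s‖ ^ 2 - p ^ 2) : ℝ) : ℂ) * s‖ ^ 2
      - (2 * p) ^ 2 / (‖s‖ ^ 2 - p ^ 2) ^ 2 =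
      4 / (‖h‖ ^ 2 * (‖s‖ ^ 2 - p ^ 2)) * (‖h - s‖ ^ 2 - p ^ 2) := by
    rw [← Complex.normSq_eq_norm_sq (_ - _), ← Complex.normSq_eq_norm_sq (h - s),
      Complex.normSq_apply, Complex.normSq_apply]
    simp only [Complex.sub_re, Complex.sub_im, Complex.re_ofReal_mul, Complex.im_ofReal_mul]
    generalize ‖h‖ ^ 2 = N at *
    generalize ‖s‖ ^ 2 = S at *
    field_simp
    subst hhN hsN
    ring
  rw [key, mul_eq_zero, or_iff_right (div_ne_zero (by norm_num) (mul_ne_zero hN hm))]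

/-! ### Identification of the explicit constants. -/

section Constants

variable {a b x y r : ℝ}

lemma csq_pos (hb : 0 < b) (hab : b < a) : 0 < csq a b := by
  unfold csq
  nlinarith

lemma δ₄'_sq (hb : 0 < b) (hab : b < a) : δ₄' a b y ^ 2 = b ^ 4 + csq a b * y ^ 2 :=
  Real.sq_sqrt (by have := csq_pos hb hab; positivity)

lemma δ₄_arg_pos (hb : 0 < b) (hab : b < a) (hG : 0 < ellipsePower a b x y) :
    0 < a ^ 4 - csq a b * x ^ 2 := by
  have hc := csq_pos hb hab
  have ha : 0 < a := hb.trans hab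
  have h1 : 0 < a ^ 2 - x ^ 2 := by
    have h2 : 0 < b ^ 2 * (a ^ 2 - x ^ 2) := by
      unfold ellipsePower at hG
      have : 0 ≤ a ^ 2 * y ^ 2 := by positivity
      linarith
    exact pos_of_mul_pos_right h2 (by positivity)
  have h2 : a ^ 4 - csq a b * x ^ 2 = a ^ 2 * b ^ 2 + csq a b * (a ^ 2 - x ^ 2) := by
    unfold csq
    ring
  rw [h2]
  positivity

lemma δ₄_sq (hb : 0 < b) (hab : b < a) (hG : 0 < ellipsePower a b x y) :
    δ₄ a b x ^ 2 = a ^ 4 - csq a b * x ^ 2 :=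
  Real.sq_sqrt (δ₄_arg_pos hb hab hG).le

lemma δ_eq (hb : 0 < b) (hab : b < a) : δ a b x y = δ₄ a b x * δ₄' a b y := by
  have := csq_pos hb hab
  rw [δ, mul_comm, δ₄, δ₄', Real.sqrt_mul' _ (by positivity)]

lemma csq_mul_ellipsePower (hb : 0 < b) (hab : b < a) (hG : 0 < ellipsePower a b x y) :
    csq a b * ellipsePower a b x y =
      (b * δ₄ a b x - a * δ₄' a b y) * (b * δ₄ a b x + a * δ₄' a b y) := by
  have h1 := δ₄_sq hb hab hG
  have h2 := δ₄'_sq (y := y) hb hab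
  unfold csq ellipsePower at *
  linear_combination -b ^ 2 * h1 + a ^ 2 * h2

lemma norm_fociSum_sq : ‖fociSum a b x y r‖ ^ 2 =
    4 * r ^ 2 * (b ^ 4 * x ^ 2 + a ^ 4 * y ^ 2) / ellipsePower a b x y ^ 2 := by
  rw [← Complex.normSq_eq_norm_sq, Complex.normSq_apply]
  simp only [fociSum]
  ring

lemma add_δ₄_pos (hb : 0 < b) (hab : b < a) (hG : 0 < ellipsePower a b x y) :
    0 < b * δ₄ a b x + a * δ₄' a b y := by
  have h1 : 0 < δ₄ a b x := Real.sqrt_pos.2 (δ₄_arg_pos hb hab hG)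
  have h2 : 0 ≤ δ₄' a b y := Real.sqrt_nonneg _
  have ha : 0 < a := hb.trans hab
  positivity

/-- The radius of the incircle is determined by its centre. -/
lemma csq_mul_radius (hb : 0 < b) (hab : b < a) (hr : 0 < r) (hG : 0 < ellipsePower a b x y)
    (hβ : fociProd a b x y r ^ 2 + 1 + conicCoeff a b x y r = ‖fociSum a b x y r‖ ^ 2)
    (hp : fociProd a b x y r < 1) : csq a b * r = b * δ₄ a b x - a * δ₄' a b y := by
  have hc := csq_pos hb hab
  have ha : 0 < a := hb.trans hab
  have h1 := δ₄_sq hb hab hG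
  have h2 := δ₄'_sq (y := y) hb hab
  have hcG := csq_mul_ellipsePower hb hab hG
  have hE : 0 ≤ δ₄' a b y := Real.sqrt_nonneg _
  have hγ := add_δ₄_pos hb hab hG
  rw [fociProd, div_lt_one hG] at hp
  rw [norm_fociSum_sq, fociProd, conicCoeff] at hβ
  field_simp at hβ
  have hM : (a ^ 2 + b ^ 2) * ellipsePower a b x y + 2 * (b ^ 4 * x ^ 2 + a ^ 4 * y ^ 2) =
      b ^ 2 * δ₄ a b x ^ 2 + a ^ 2 * δ₄' a b y ^ 2 := by
    rw [h1, h2, ellipsePower, csq]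
    ring
  set D := δ₄ a b x
  set E := δ₄' a b y
  set G := ellipsePower a b x y
  set c := csq a b
  have hα : 0 < b * D - a * E := by
    refine pos_of_mul_pos_left ?_ hγ.le
    rw [← hcG]
    positivity
  -- The relation `hβ` is quadratic in `r²` with roots `(cr)² = (bD ∓ aE)²`; the bound from `hp`
  -- discards the larger one.
  have hlt : (c * r) ^ 2 < (b * D + a * E) ^ 2 := by
    have h3 : (c * r) ^ 2 < (b * D - a * E) * (b * D + a * E) := by
      rw [← hcG]
      have := mul_lt_mul_of_pos_left hp hc
      linarith
    have h4 : (b * D - a * E) * (b * D + a * E) ≤ (b * D + a * E) * (b * D + a * E) := by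
      apply mul_le_mul_of_nonneg_right _ hγ.le
      nlinarith
    linarith
  have hfac : ((c * r) ^ 2 - (b * D - a * E) ^ 2) * ((c * r) ^ 2 - (b * D + a * E) ^ 2) = 0 := by
    have hq : r ^ 4 * c ^ 2 + G ^ 2 - 2 * r ^ 2 * (b ^ 2 * D ^ 2 + a ^ 2 * E ^ 2) = 0 := by
      linear_combination hβ + 2 * r ^ 2 * hM
    linear_combination c ^ 2 * hq - (c * G + (b * D - a * E) * (b * D + a * E)) * hcG
  have h5 := (mul_eq_zero.1 hfac).resolve_right (by linarith)
  exact (sq_eq_sq₀ (by positivity) hα.le).1 (by linarith)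

/-- The factorization of `z₁` over the square roots that define the locus. -/
lemma csq_mul_z₁ (hb : 0 < b) (hab : b < a) (hG : 0 < ellipsePower a b x y) :
    csq a b * z₁ a b x y =
      (b * (a ^ 2 + 3 * b ^ 2) * δ₄ a b x - a * (3 * a ^ 2 + b ^ 2) * δ₄' a b y) *
      (b * (a ^ 2 + 3 * b ^ 2) * δ₄ a b x + a * (3 * a ^ 2 + b ^ 2) * δ₄' a b y) := by
  have h1 := δ₄_sq hb hab hG
  have h2 := δ₄'_sq (y := y) hb hab
  unfold z₁ z₂
  unfold csq at *
  linear_combination -(b * (a ^ 2 + 3 * b ^ 2)) ^ 2 * h1 + (a * (3 * a ^ 2 + b ^ 2)) ^ 2 * h2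

/-- The last factor also occurs in `csq_mul_z₁`, `y₃₆_eq` and `csq_mul_radius_numerator`; it cancels
from the centre and from the radius. -/
lemma x₃₆_eq (hb : 0 < b) (hab : b < a) (hG : 0 < ellipsePower a b x y) :
    x₃₆ a b x y = x * (b * δ₄ a b x - 3 * a * δ₄' a b y) *
      (b * (a ^ 2 + 3 * b ^ 2) * δ₄ a b x + a * (3 * a ^ 2 + b ^ 2) * δ₄' a b y) := by
  have h1 := δ₄_sq hb hab hG
  have h2 := δ₄'_sq (y := y) hb hab
  rw [x₃₆, δ_eq hb hab]
  unfold z₂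
  unfold csq at *
  linear_combination -x * b ^ 2 * (a ^ 2 + 3 * b ^ 2) * h1
    + 3 * x * a ^ 2 * (3 * a ^ 2 + b ^ 2) * h2

lemma y₃₆_eq (hb : 0 < b) (hab : b < a) (hG : 0 < ellipsePower a b x y) :
    y₃₆ a b x y = y * (a * δ₄' a b y - 3 * b * δ₄ a b x) *
      (b * (a ^ 2 + 3 * b ^ 2) * δ₄ a b x + a * (3 * a ^ 2 + b ^ 2) * δ₄' a b y) := by
  have h1 := δ₄_sq hb hab hG
  have h2 := δ₄'_sq (y := y) hb hab
  rw [y₃₆, δ_eq hb hab]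
  unfold csq at *
  linear_combination 3 * y * b ^ 2 * (a ^ 2 + 3 * b ^ 2) * h1
    - y * a ^ 2 * (3 * a ^ 2 + b ^ 2) * h2

/-- The factor `csq a b` allows `x²` and `y²` to be eliminated in favour of `δ₄` and `δ₄'`. By
`csq_mul_radius` the squared factor is `(csq a b * r)²`. -/
lemma csq_mul_radius_numerator (hb : 0 < b) (hab : b < a) (hG : 0 < ellipsePower a b x y) :
    csq a b * (δ₄ a b x * z₃₆ a b x y - δ₄' a b y * z₃₆' a b x y) =
      -(b * δ₄ a b x - a * δ₄' a b y) ^ 2 *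
      (b * (a ^ 2 + 3 * b ^ 2) * δ₄ a b x + a * (3 * a ^ 2 + b ^ 2) * δ₄' a b y) := by
  have h1 := δ₄_sq hb hab hG
  have h2 := δ₄'_sq (y := y) hb hab
  have hx : csq a b * x ^ 2 = a ^ 4 - δ₄ a b x ^ 2 := by linear_combination h1
  have hy : csq a b * y ^ 2 = δ₄' a b y ^ 2 - b ^ 4 := by linear_combination -h2
  generalize δ₄ a b x = D at *
  generalize δ₄' a b y = E at *
  unfold z₃₆ z₃₆'
  have hc : csq a b = a ^ 2 - b ^ 2 := rfl
  linear_combination (D * (b ^ 3 * a ^ 2 + 3 * b ^ 5) - E * (5 * a * b ^ 4 - a ^ 3 * b ^ 2)) * hx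
    + (D * (5 * b * a ^ 4 - b ^ 3 * a ^ 2) - E * (a ^ 3 * b ^ 2 + 3 * a ^ 5)) * hy
    + (D * (b ^ 5 * a ^ 2 - b ^ 3 * a ^ 4) - E * (a ^ 5 * b ^ 2 - a ^ 3 * b ^ 4)) * hc

lemma r36_eq : r36 a b x y =
    |2 * (δ₄ a b x * z₃₆ a b x y - δ₄' a b y * z₃₆' a b x y) / z₁ a b x y| := by
  rw [r36]
  congr 2
  unfold z₁ z₂ csq
  ring

/-- The power of the origin with respect to the circle of orthocentres. -/
lemma norm_fociSum_sq_sub (hb : 0 < b) (hab : b < a) (hr : 0 < r)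
    (hG : 0 < ellipsePower a b x y)
    (hβ : fociProd a b x y r ^ 2 + 1 + conicCoeff a b x y r = ‖fociSum a b x y r‖ ^ 2)
    (hp : fociProd a b x y r < 1) :
    ‖fociSum a b x y r‖ ^ 2 - fociProd a b x y r ^ 2 =
      -(r * (b * (a ^ 2 + 3 * b ^ 2) * δ₄ a b x - a * (3 * a ^ 2 + b ^ 2) * δ₄' a b y)) /
        (csq a b * ellipsePower a b x y) := by
  have hcr := csq_mul_radius hb hab hr hG hβ hp
  have hcG := csq_mul_ellipsePower hb hab hG
  have hc := csq_pos hb hab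
  rw [← hβ, conicCoeff]
  -- One factor in `csq_mul_ellipsePower` is `csq a b * r`, which leaves this value for the power.
  have hG' : ellipsePower a b x y = r * (b * δ₄ a b x + a * δ₄' a b y) := by
    apply mul_left_cancel₀ hc.ne'
    rw [hcG, ← hcr]
    ring
  field_simp
  have hc' : csq a b = a ^ 2 - b ^ 2 := rfl
  linear_combination csq a b * hG' - 2 * r * (a ^ 2 + b ^ 2) * hcr
    + r * (b * δ₄ a b x + a * δ₄' a b y) * hc'

lemma C36_eq (hb : 0 < b) (hab : b < a) (hr : 0 < r) (hG : 0 < ellipsePower a b x y)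
    (hβ : fociProd a b x y r ^ 2 + 1 + conicCoeff a b x y r = ‖fociSum a b x y r‖ ^ 2)
    (hp : fociProd a b x y r < 1) (hz : z₁ a b x y ≠ 0) :
    C36 a b x y = pt !₂[x, y] r
      (((2 / (‖fociSum a b x y r‖ ^ 2 - fociProd a b x y r ^ 2) : ℝ) : ℂ) * fociSum a b x y r) := by
  have hcr := csq_mul_radius hb hab hr hG hβ hp
  have hc := csq_pos hb hab
  have hzz := csq_mul_z₁ hb hab hG
  have hne := mul_ne_zero hc.ne' hz
  rw [norm_fociSum_sq_sub hb hab hr hG hβ hp]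
  have hxx := x₃₆_eq hb hab hG
  have hyy := y₃₆_eq hb hab hG
  rw [hzz] at hne
  obtain ⟨hL, hL'⟩ := mul_ne_zero_iff.1 hne
  have hz' := eq_div_of_mul_eq hc.ne' ((mul_comm _ _).trans hzz)
  have hc' : csq a b = a ^ 2 - b ^ 2 := rfl
  refine plane_ext ?_ ?_
  · simp only [pt_apply_zero, Complex.re_ofReal_mul, fociSum]
    change x₃₆ a b x y / z₁ a b x y = x + _
    rw [hxx, hz']
    set L' := b * (a ^ 2 + 3 * b ^ 2) * δ₄ a b x + a * (3 * a ^ 2 + b ^ 2) * δ₄' a b y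
    set L := b * (a ^ 2 + 3 * b ^ 2) * δ₄ a b x - a * (3 * a ^ 2 + b ^ 2) * δ₄' a b y with hLdef
    field_simp
    rw [hLdef]
    linear_combination x * (b * δ₄ a b x - 3 * a * δ₄' a b y) * hc' + 4 * b ^ 2 * x * hcr
  · simp only [pt_apply_one, Complex.im_ofReal_mul, fociSum]
    change y₃₆ a b x y / z₁ a b x y = y + _
    rw [hyy, hz']
    set L' := b * (a ^ 2 + 3 * b ^ 2) * δ₄ a b x + a * (3 * a ^ 2 + b ^ 2) * δ₄' a b y
    set L := b * (a ^ 2 + 3 * b ^ 2) * δ₄ a b x - a * (3 * a ^ 2 + b ^ 2) * δ₄' a b y with hLdef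
    field_simp
    rw [hLdef]
    linear_combination y * (a * δ₄' a b y - 3 * b * δ₄ a b x) * hc' + 4 * a ^ 2 * y * hcr

lemma r36_eq_mul (hb : 0 < b) (hab : b < a) (hr : 0 < r) (hG : 0 < ellipsePower a b x y)
    (hβ : fociProd a b x y r ^ 2 + 1 + conicCoeff a b x y r = ‖fociSum a b x y r‖ ^ 2)
    (hp : fociProd a b x y r < 1) (hz : z₁ a b x y ≠ 0) :
    r36 a b x y = r * (2 * fociProd a b x y r /
      |‖fociSum a b x y r‖ ^ 2 - fociProd a b x y r ^ 2|) := by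
  have hcr := csq_mul_radius hb hab hr hG hβ hp
  have hc := csq_pos hb hab
  have hzz := csq_mul_z₁ hb hab hG
  have hnum := csq_mul_radius_numerator hb hab hG
  have hne := mul_ne_zero hc.ne' hz
  rw [hzz] at hne
  obtain ⟨hL, hL'⟩ := mul_ne_zero_iff.1 hne
  rw [norm_fociSum_sq_sub hb hab hr hG hβ hp, r36_eq]
  have hP : 0 < fociProd a b x y r := by
    unfold fociProd
    positivity
  have hmul (t : ℝ) : r * |t| = |r * t| := by rw [abs_mul, abs_of_pos hr]
  rw [← abs_of_pos (mul_pos two_pos hP), ← abs_div, hmul]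
  congr 1
  rw [← hcr] at hnum
  have hz' := eq_div_of_mul_eq hc.ne' ((mul_comm _ _).trans hzz)
  have hnum' := eq_div_of_mul_eq hc.ne' ((mul_comm _ _).trans hnum)
  rw [hz', hnum', fociProd]
  set L' := b * (a ^ 2 + 3 * b ^ 2) * δ₄ a b x + a * (3 * a ^ 2 + b ^ 2) * δ₄' a b y
  set L := b * (a ^ 2 + 3 * b ^ 2) * δ₄ a b x - a * (3 * a ^ 2 + b ^ 2) * δ₄' a b y
  field_simp

/-- The degenerate case: the circle of orthocentres passes through `0`, the centre of the inversion.
-/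
lemma z₁_eq_zero_of_norm_eq (hb : 0 < b) (hab : b < a) (hr : 0 < r)
    (hG : 0 < ellipsePower a b x y)
    (hβ : fociProd a b x y r ^ 2 + 1 + conicCoeff a b x y r = ‖fociSum a b x y r‖ ^ 2)
    (hp : fociProd a b x y r < 1)
    (h : ‖fociSum a b x y r‖ ^ 2 - fociProd a b x y r ^ 2 = 0) : z₁ a b x y = 0 := by
  have hc := csq_pos hb hab
  have hzz := csq_mul_z₁ hb hab hG
  rw [norm_fociSum_sq_sub hb hab hr hG hβ hp, div_eq_zero_iff,
    or_iff_left (by positivity), neg_eq_zero, mul_eq_zero, or_iff_right hr.ne'] at h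
  rw [h, zero_mul, mul_eq_zero, or_iff_right hc.ne'] at hzz
  exact hzz

end Constants

end Poncelet

/-! ### The locus. -/

theorem mainTheorem1 (a b xc yc r : ℝ) (hb : 0 < b) (hab : b < a)
    (hfam : (Poncelet.family a b !₂[xc, yc] r).Nonempty)
    (hz : Poncelet.z₁ a b xc yc ≠ 0) :
    (∀ T ∈ Poncelet.family a b !₂[xc, yc] r, T.incenter ≠ T.circumcenter) ∧
      0 < Poncelet.r36 a b xc yc ∧
      Poncelet.locus36 a b !₂[xc, yc] r =
        Metric.sphere (Poncelet.C36 a b xc yc) (Poncelet.r36 a b xc yc) := by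
  open Poncelet in
  have ha : 0 < a := hb.trans hab
  obtain ⟨T₀, hT₀⟩ := hfam
  have hr : 0 < r := (exists_normals_of_insphere hT₀.2).1
  have hG := ellipsePower_pos ha hb hT₀
  have hP : 0 < fociProd a b xc yc r := by
    have := csq_pos hb hab
    unfold fociProd
    positivity
  obtain ⟨u₀, v₀, w₀, hu₀, hv₀, hw₀, hlt₀, hc₀⟩ := exists_hasContact hT₀.2
  -- `hβ` involves only the ellipse and the circle, so this one triangle supplies it for every
  -- triangle built below.
  obtain ⟨he₀, hβ⟩ := closure_of_mem_family ha hb hT₀ hu₀ hv₀ hw₀ hlt₀ hc₀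
  have hs := norm_fociSum_lt hb hr hG hβ
  have hp1 : fociProd a b xc yc r < 1 :=
    lt_one_of_norm_lt hP hs (ε := u₀ * v₀ * w₀) (by simp [hu₀, hv₀, hw₀]) (by rwa [← he₀])
  have hC := C36_eq hb hab hr hG hβ hp1 hz
  have hR := r36_eq_mul hb hab hr hG hβ hp1 hz
  have hm : ‖fociSum a b xc yc r‖ ^ 2 - fociProd a b xc yc r ^ 2 ≠ 0 :=
    fun h ↦ hz (z₁_eq_zero_of_norm_eq hb hab hr hG hβ hp1 h)
  rw [abs_of_pos (by linarith)] at hs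
  set p := fociProd a b xc yc r
  set s := fociSum a b xc yc r
  have hne {h : ℂ} (hh : ‖h - s‖ = p) : h ≠ 0 := by
    rintro rfl
    rw [zero_sub, norm_neg] at hh
    exact hm (by rw [hh, sub_self])
  have hnorm {u v w : ℂ} (hu : ‖u‖ = 1) (hv : ‖v‖ = 1) (hw : ‖w‖ = 1)
      (he : u + v + w = s + p * (u * v * w)) : ‖u + v + w - s‖ = p := by
    rw [he, add_sub_cancel_left, norm_mul, Complex.norm_of_nonneg hP.le, norm_mul, norm_mul,
      hu, hv, hw]
    ring
  refine ⟨fun T hT ↦ ?_, ?_, Set.Subset.antisymm ?_ ?_⟩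
  · obtain ⟨u, v, w, hu, hv, hw, hlt, hc⟩ := exists_hasContact hT.2
    obtain ⟨he, -⟩ := closure_of_mem_family ha hb hT hu hv hw hlt hc
    exact incenter_ne_circumcenter hr hu hv hw hlt (hne (hnorm hu hv hw he)) hc
      (incenter_eq_of_insphere hT.2)
  · rw [hR]
    positivity
  · rintro _ ⟨T, hT, rfl⟩
    obtain ⟨u, v, w, hu, hv, hw, hlt, hc⟩ := exists_hasContact hT.2
    obtain ⟨he, -⟩ := closure_of_mem_family ha hb hT hu hv hw hlt hc
    have hn := hnorm hu hv hw he
    rw [Metric.mem_sphere, X36_eq hr hu hv hw hlt (hne hn) hc (incenter_eq_of_insphere hT.2), hC,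
      hR, dist_pt _ hr.le, (norm_inverse_sub hm hP (hne hn)).2 hn]
  · intro Q hQ
    obtain ⟨q, rfl⟩ := exists_eq_pt !₂[xc, yc] hr.ne' Q
    rw [Metric.mem_sphere, hC, hR, dist_pt _ hr.le, mul_right_inj' hr.ne'] at hQ
    have hq : q ≠ 0 := by
      rintro rfl
      rw [zero_sub, norm_neg, norm_mul, Complex.norm_real, Real.norm_eq_abs, abs_div, abs_two,
        div_mul_eq_mul_div, div_left_inj' (abs_ne_zero.2 hm), mul_right_inj' two_ne_zero] at hQ
      exact hm (by rw [hQ, sub_self])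
    -- The map `h ↦ 2h/‖h‖²` is an involution, so the preimage of `q` is `2q/‖q‖²`.
    obtain ⟨h, h0, rfl⟩ : ∃ h : ℂ, h ≠ 0 ∧ ((2 / ‖h‖ ^ 2 : ℝ) : ℂ) * h = q := by
      have hN : ‖q‖ ≠ 0 := norm_ne_zero_iff.2 hq
      refine ⟨((2 / ‖q‖ ^ 2 : ℝ) : ℂ) * q, mul_ne_zero ?_ hq, ?_⟩
      · rw [Complex.ofReal_ne_zero]
        positivity
      · rw [norm_mul, Complex.norm_of_nonneg (by positivity), ← mul_assoc, ← Complex.ofReal_mul]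
        convert! one_mul q
        rw [← Complex.ofReal_one]
        congr 1
        field_simp
    rw [norm_inverse_sub hm hP h0] at hQ
    -- The closure condition forces the product `uvw` to be `(h - s)/p`.
    have hε : ‖(h - s) / p‖ = 1 := by
      rw [norm_div, hQ, Complex.norm_of_nonneg hP.le, div_self hP.ne']
    have hpC : (p : ℂ) ≠ 0 := Complex.ofReal_ne_zero.2 hP.ne'
    have hh : ‖h‖ < 1 := by
      have : ‖h‖ ≤ ‖h - s‖ + ‖s‖ := by simpa using norm_add_le (h - s) s
      linarith
    obtain ⟨u, v, w, hu, hv, hw, rfl, hprod⟩ := exists_unit_triple hh hε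
    obtain ⟨T, hc, hT⟩ := exists_triangle_hasContact !₂[xc, yc] hr hu hv hw hh
    refine ⟨T, mem_family_of_closure ha hb hG.ne' hT hu hv hw hh hc ?_ hβ,
      X36_eq hr hu hv hw hh h0 hc (incenter_eq_of_insphere hT)⟩
    rw [hprod, mul_div_cancel₀ _ hpC]
    ring
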